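/- Let $\rho>0$, let $a:[0,1]\to\mathbb{R}$ be continuous, let $q_0,q_1\in\mathbb{R}$, and consider on the complex Hilbert space $X=L_2(0,1)$ the operator $\mathcal{A}h=\rho h''+ah$ with domain $D(\mathcal{A})=\{h\in H^2(0,1)\mid h'(0)=q_0h(0),\ h'(1)=q_1h(1)\}$. Let $\lambda_1>\lambda_2>\dots$ be its (real, simple) eigenvalues in decreasing order, and let $\phi_i$, $i\in\mathbb{N}$, be corresponding real-valued eigenvectors with $\|\phi_i\|_{L_2}=1$. For $n\ge 0$ put $\Lambda_n=\operatorname{diag}(\lambda_1,\dots,\lambda_n)$, $b_i=\rho\,(-\phi_i(0),\phi_i(1))^{T}\in\mathbb{R}^2$, let $B_n$ be the $n\times 2$ matrix with rows $b_1^{T},\dots,b_n^{T}$, and let $\Lambda_\infty=\operatorname{diag}(\lambda_{n+1},\lambda_{n+2},\dots)$, an operator on $\ell_2$ with spectrum $\sigma(\Lambda_\infty)=\{\lambda_{n+1},\lambda_{n+2},\dots\}$. Let a feedback gain $K\in\mathbb{C}^{2\times n}$ assign the closed-loop eigenvalues $\tilde\lambda_1,\dots,\tilde\lambda_n\in\mathbb{C}$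 with parameter vectors $p_1,\dots,p_n\in\mathbb{C}^2$, i.e., there are nonzero vectors $\tilde v_1,\dots,\tilde v_n\in\mathbb{C}^n$ with $(\Lambda_n-\tilde\lambda_iI)\tilde v_i=B_np_i$ and $p_i=K\tilde v_i$ for $i=1,\dots,n$, so that $(\Lambda_n-B_nK)\tilde v_i=\tilde\lambda_i\tilde v_i$. (For example, $\tilde\lambda_i\notin\{\lambda_1,\dots,\lambda_n\}$, $\tilde v_i=(\Lambda_n-\tilde\lambda_iI)^{-1}B_np_i$ linearly independent, and $K=[p_1\,\cdots\,p_n][\tilde v_1\,\cdots\,\tilde v_n]^{-1}$.) Put $P=[p_1\,\cdots\,p_n]$, $\tilde V=[\tilde v_1\,\cdots\,\tilde v_n]$, $\tilde\Lambda_n=\operatorname{diag}(\tilde\lambda_1,\dots,\tilde\lambda_n)$. Suppose that $\tilde\lambda_1,\dots,\tilde\lambda_n$ are distinct and not contained in $\sigma(\Lambda_\infty)$. (Then $\tilde V$ and $\tilde\Lambda_n-\lambda_iI$, $i>n$, are invertible.) Define $c_i\in\mathbb{C}^n$ by $\overline{c_i}^{T}=e_i^{T}\tilde V^{-1}$ for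 $i\le n$ and $\overline{c_i}^{T}=b_i^{T}P(\tilde\Lambda_n-\lambda_iI)^{-1}\tilde V^{-1}$ for $i>n$, where $e_i$ is the $i$-th unit vector, and let $$\tilde\psi_i=\begin{cases}\sum_{j=1}^n c_{i,j}\phi_j, & i\le n,\\[2pt] \phi_i+\sum_{j=1}^n c_{i,j}\phi_j, & i>n.\end{cases}$$ Then $\{\tilde\psi_i\}_{i\in\mathbb{N}}$ is a Riesz basis of $X$: its linear span is dense in $X$, and there are constants $m,M>0$ such that $m\sum_i|\alpha_i|^2\le\|\sum_i\alpha_i\tilde\psi_i\|_{L_2}^2\le M\sum_i|\alpha_i|^2$ for all finitely supported complex sequences $(\alpha_i)$. -/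

import Mathlib

open MeasureTheory

noncomputable section

/-- Lebesgue measure on the interval `(0,1)`. -/
abbrev unitVol : Measure ℝ := volume.restrict (Set.Ioo (0 : ℝ) 1)

/-- The complex Hilbert space `L₂(0,1)`. -/
abbrev StateSpace : Type := Lp ℂ 2 unitVol

/-- `h ∈ H²(0,1)`, where `h` is the continuously differentiable representative on `[0,1]`, `h₁` is
its derivative (so that `h 0`, `h 1`, `h₁ 0`, `h₁ 1` are the boundary values) and `h₂` is the
second derivative: `h`, `h₁` are absolutely continuous on `[0,1]`, being primitives of `h₁`, `h₂`,
and `h, h₁, h₂ ∈ L₂(0,1)`. -/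
structure IsSobolevH2 (h h₁ h₂ : ℝ → ℂ) : Prop where
  memLp : MemLp h 2 unitVol
  memLp_one : MemLp h₁ 2 unitVol
  memLp_two : MemLp h₂ 2 unitVol
  primitive_one : ∀ z ∈ Set.Icc (0 : ℝ) 1, h z = h 0 + ∫ t in (0 : ℝ)..z, h₁ t
  primitive_two : ∀ z ∈ Set.Icc (0 : ℝ) 1, h₁ z = h₁ 0 + ∫ t in (0 : ℝ)..z, h₂ t

/-- The graph of the operator `𝒜 h = ρ h'' + a h` with domain
`{h ∈ H²(0,1) | h'(0) = q₀ h(0), h'(1) = q₁ h(1)}`: `h` is in the domain and `𝒜 h = g`. -/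
def SLGraph (ρ : ℝ) (a : ℝ → ℝ) (q₀ q₁ : ℝ) (h g : ℝ → ℂ) : Prop :=
  ∃ h₁ h₂ : ℝ → ℂ, IsSobolevH2 h h₁ h₂ ∧
    h₁ 0 = q₀ * h 0 ∧ h₁ 1 = q₁ * h 1 ∧
    ∀ᵐ z ∂unitVol, g z = ρ * h₂ z + a z * h z

/-- `h` is an eigenvector of `𝒜` for the eigenvalue `μ`. -/
def IsEigenpair (ρ : ℝ) (a : ℝ → ℝ) (q₀ q₁ : ℝ) (μ : ℂ) (h : ℝ → ℂ) : Prop :=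
  SLGraph ρ a q₀ q₁ h (fun z => μ * h z) ∧ ¬ ∀ᵐ z ∂unitVol, h z = 0

/-- `lam 0 > lam 1 > ...` are the real eigenvalues of `𝒜` (it has no others, as it is
self-adjoint), and `φ i` is a real-valued eigenvector for `lam i` of norm one in `L₂(0,1)`. -/
structure IsEigensystem (ρ : ℝ) (a : ℝ → ℝ) (q₀ q₁ : ℝ) (lam : ℕ → ℝ) (φ : ℕ → ℝ → ℝ) :
    Prop where
  strictAnti : StrictAnti lam
  exhaustive : ∀ μ : ℝ, (∃ h, IsEigenpair ρ a q₀ q₁ (μ : ℂ) h) → ∃ i, lam i = μ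
  eigen : ∀ i, IsEigenpair ρ a q₀ q₁ (lam i : ℂ) (fun z => (φ i z : ℂ))
  normalized : ∀ i, ∫ z in (0 : ℝ)..1, φ i z ^ 2 = 1

theorem IsEigensystem.memLp {ρ : ℝ} {a : ℝ → ℝ} {q₀ q₁ : ℝ} {lam : ℕ → ℝ} {φ : ℕ → ℝ → ℝ}
    (hs : IsEigensystem ρ a q₀ q₁ lam φ) (i : ℕ) :
    MemLp (fun z => (φ i z : ℂ)) 2 unitVol := by
  obtain ⟨⟨_, _, h, _⟩, _⟩ := hs.eigen i
  exact h.memLp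

/-- The eigenvector `φ i` as an element of `L₂(0,1)`. -/
def IsEigensystem.vec {ρ : ℝ} {a : ℝ → ℝ} {q₀ q₁ : ℝ} {lam : ℕ → ℝ} {φ : ℕ → ℝ → ℝ}
    (hs : IsEigensystem ρ a q₀ q₁ lam φ) (i : ℕ) : StateSpace :=
  (hs.memLp i).toLp (fun z => (φ i z : ℂ))

/-- The vector `b_i = ρ (-φ_i(0), φ_i(1))`. -/
def inputVec (ρ : ℝ) (φ : ℕ → ℝ → ℝ) (i : ℕ) : Fin 2 → ℂ :=
  ![(ρ : ℂ) * (-(φ i 0 : ℂ)), (ρ : ℂ) * (φ i 1 : ℂ)]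

/-- The matrix `B_n` with the rows `b_iᵀ` of the first `n` modes. -/
def inputMatrix (ρ : ℝ) (φ : ℕ → ℝ → ℝ) (n : ℕ) : Matrix (Fin n) (Fin 2) ℂ :=
  Matrix.of fun i => inputVec ρ φ i

/-- The matrix `Λ_n`, diagonal with the first `n` open-loop eigenvalues. -/
def lamMatrix (lam : ℕ → ℝ) (n : ℕ) : Matrix (Fin n) (Fin n) ℂ :=
  Matrix.diagonal fun i => (lam i : ℂ)

/-- The spectrum of the diagonal operator `Λ_∞` on `ℓ₂`, whose diagonal entries are the
eigenvalues after the first `n`. -/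
def spectrumTail (lam : ℕ → ℝ) (n : ℕ) : Set ℂ :=
  {μ | ∃ j, n ≤ j ∧ μ = (lam j : ℂ)}

/-- The gain `K` assigns the eigenvalues `lamt i` with the parameter vectors `p i` (the columns
of `P`) and the closed-loop eigenvectors `v i` (the columns of `V`), which are nonzero:
`(Λ_n - lamt i I) v i = B_n (p i)` and `p i = K (v i)`.
In particular `(Λ_n - B_n K) (v i) = lamt i (v i)`. -/
structure IsAssignedBy {n : ℕ} (Lam : Matrix (Fin n) (Fin n) ℂ) (B : Matrix (Fin n) (Fin 2) ℂ)
    (K : Matrix (Fin 2) (Fin n) ℂ) (lamt : Fin n → ℂ)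
    (P : Matrix (Fin 2) (Fin n) ℂ) (V : Matrix (Fin n) (Fin n) ℂ) : Prop where
  ne_zero : ∀ i, V.col i ≠ 0
  modal : ∀ i, (Lam - lamt i • (1 : Matrix (Fin n) (Fin n) ℂ)).mulVec (V.col i)
    = B.mulVec (P.col i)
  gain : ∀ i, P.col i = K.mulVec (V.col i)

/-- The row vector `c̄_iᵀ`: it is `e_iᵀ V⁻¹` for the first `n` indices and
`b_iᵀ P (Λ̃_n - λ_i I)⁻¹ V⁻¹` for the others. -/
def coeffRow (ρ : ℝ) (lam : ℕ → ℝ) (φ : ℕ → ℝ → ℝ) {n : ℕ} (lamt : Fin n → ℂ)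
    (P : Matrix (Fin 2) (Fin n) ℂ) (V : Matrix (Fin n) (Fin n) ℂ) (i : ℕ) : Fin n → ℂ :=
  if hi : i < n then V⁻¹.row ⟨i, hi⟩
  else Matrix.vecMul (inputVec ρ φ i)
    (P * (Matrix.diagonal lamt - (lam i : ℂ) • (1 : Matrix (Fin n) (Fin n) ℂ))⁻¹ * V⁻¹)

/-- The vector `ψ̃_i`: it is `c_iᵀ (φ_1, ..., φ_n)` for the first `n` indices and
`c_iᵀ (φ_1, ..., φ_n) + φ_i` for the others. -/
def closedLoopVec {ρ : ℝ} {a : ℝ → ℝ} {q₀ q₁ : ℝ} {lam : ℕ → ℝ} {φ : ℕ → ℝ → ℝ}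
    (hs : IsEigensystem ρ a q₀ q₁ lam φ) {n : ℕ} (lamt : Fin n → ℂ)
    (P : Matrix (Fin 2) (Fin n) ℂ) (V : Matrix (Fin n) (Fin n) ℂ) (i : ℕ) : StateSpace :=
  (∑ j : Fin n, star (coeffRow ρ lam φ lamt P V i j) • hs.vec j)
    + (if i < n then 0 else hs.vec i)

/-- A Riesz basis of a Hilbert space: the span of the sequence is dense, and the norm of a finite
linear combination is equivalent to the `ℓ₂`-norm of its coefficients. -/
def IsRieszBasis {H : Type*} [NormedAddCommGroup H] [InnerProductSpace ℂ H] (e : ℕ → H) : Prop :=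
  (Submodule.span ℂ (Set.range e)).topologicalClosure = ⊤ ∧
  ∃ m M : ℝ, 0 < m ∧ 0 < M ∧ ∀ (s : Finset ℕ) (α : ℕ → ℂ),
    m * ∑ i ∈ s, ‖α i‖ ^ 2 ≤ ‖∑ i ∈ s, α i • e i‖ ^ 2 ∧
    ‖∑ i ∈ s, α i • e i‖ ^ 2 ≤ M * ∑ i ∈ s, ‖α i‖ ^ 2

end

/-!
The eigenvectors `φ i` form an orthonormal basis because `𝒜 - κ`, for `κ > λ₁`, has a compact
symmetric inverse. With respect to this basis `ψ̃ i = R (φ i)`, where `R` is a perturbation of the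
identity by an operator of rank at most `n`. That operator is bounded because, for every `α`, the
sequence `b_iᵀ α / (μ - λ_i)` is square-summable, even though `b_iᵀ α` itself need not be: Green's
identity with an `H²` function that vanishes at both ends and has there the derivatives `α` writes
`b_iᵀ α` as `⟪φ i, F⟫ - λ_i ⟪φ i, G⟫` with `F, G ∈ L₂(0,1)`. Finally `R` is block triangular with
invertible diagonal blocks, one given by `V⁻¹` and the other the identity, so it is injective, and
by the Fredholm alternative an isomorphism.
-/

open Set Filter
open scoped Topology ComplexConjugate

section AbsolutelyContinuous

variable {E : Type*} [NormedAddCommGroup E] {a b : ℝ}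

theorem absolutelyContinuousOnInterval_of_dist_le {X Y : Type*} [PseudoMetricSpace X]
    [PseudoMetricSpace Y] {f : ℝ → X} {g : ℝ → Y} (hg : AbsolutelyContinuousOnInterval g a b)
    (h : ∀ x ∈ uIcc a b, ∀ y ∈ uIcc a b, dist (f x) (f y) ≤ dist (g x) (g y)) :
    AbsolutelyContinuousOnInterval f a b := by
  refine squeeze_zero' (.of_forall fun I => Finset.sum_nonneg fun _ _ => dist_nonneg) ?_ hg
  filter_upwards [mem_inf_of_right (mem_principal_self _)] with I hI
  exact Finset.sum_le_sum fun i hi => h _ (hI.1 i hi).1 _ (hI.1 i hi).2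

variable [NormedSpace ℝ E] {F f : ℝ → E}

theorem primitive_sub_eq_integral (hf : IntervalIntegrable f volume a b)
    (hF : ∀ z ∈ uIcc a b, F z = F a + ∫ t in a..z, f t) {x y : ℝ} (hx : x ∈ uIcc a b)
    (hy : y ∈ uIcc a b) : F x - F y = ∫ t in y..x, f t := by
  have hi : ∀ z ∈ uIcc a b, IntervalIntegrable f volume a z :=
    fun z hz => hf.mono_set (uIcc_subset_uIcc_left hz)
  rw [hF x hx, hF y hy, add_sub_add_left_eq_sub,
    intervalIntegral.integral_interval_sub_left (hi x hx) (hi y hy)]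

theorem absolutelyContinuousOnInterval_of_primitive (hf : IntervalIntegrable f volume a b)
    (hF : ∀ z ∈ uIcc a b, F z = F a + ∫ t in a..z, f t) :
    AbsolutelyContinuousOnInterval F a b := by
  refine absolutelyContinuousOnInterval_of_dist_le
    (hf.norm.absolutelyContinuousOnInterval_intervalIntegral left_mem_uIcc) fun x hx y hy => ?_
  rw [dist_eq_norm, dist_eq_norm, primitive_sub_eq_integral hf hF hx hy, Real.norm_eq_abs,
    intervalIntegral.integral_interval_sub_left (hf.norm.mono_set (uIcc_subset_uIcc_left hx))
      (hf.norm.mono_set (uIcc_subset_uIcc_left hy))]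
  exact intervalIntegral.norm_integral_le_abs_integral_norm

theorem ae_hasDerivAt_of_primitive [CompleteSpace E] (hf : IntervalIntegrable f volume a b)
    (hF : ∀ z ∈ uIcc a b, F z = F a + ∫ t in a..z, f t) :
    ∀ᵐ z, z ∈ uIcc a b → HasDerivAt F (f z) z := by
  have hne : ∀ c : ℝ, ∀ᵐ z, z ≠ c := fun c => by simp [ae_iff]
  filter_upwards [hf.ae_hasDerivAt_integral, hne (min a b), hne (max a b)] with z hz hza hzb hzm
  refine ((hz hzm a left_mem_uIcc).const_add (F a)).congr_of_eventuallyEq ?_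
  filter_upwards [Ioo_mem_nhds (hzm.1.lt_of_ne' hza) (hzm.2.lt_of_ne hzb)] with y hy
  exact hF y (Ioo_subset_Icc_self hy)

theorem integral_eq_sub_of_absolutelyContinuousOnInterval [CompleteSpace E]
    (hf : IntervalIntegrable f volume a b) (hF : AbsolutelyContinuousOnInterval F a b)
    (hd : ∀ᵐ z, z ∈ uIcc a b → HasDerivAt F (f z) z) : ∫ t in a..b, f t = F b - F a := by
  have hP : ∀ z ∈ uIcc a b, (∫ t in a..z, f t) = (∫ t in a..a, f t) + ∫ t in a..z, f t := by simp
  have hac := hF.sub (absolutelyContinuousOnInterval_of_primitive hf hP)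
  obtain ⟨C, hC⟩ := hac.const_of_ae_hasDerivAt_zero (by
    filter_upwards [hd, ae_hasDerivAt_of_primitive hf hP] with z hz hz' hzm
    simpa using (hz hzm).sub (hz' hzm))
  have hab := (hC b right_mem_uIcc).trans (hC a left_mem_uIcc).symm
  simp only [Pi.sub_apply, intervalIntegral.integral_same, sub_zero] at hab
  rw [← hab, sub_sub_cancel]

theorem integral_mul_add_mul_of_primitive {𝕜 : Type*} [RCLike 𝕜] {F G f g : ℝ → 𝕜}
    (hf : IntervalIntegrable f volume a b) (hg : IntervalIntegrable g volume a b)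
    (hF : ∀ z ∈ uIcc a b, F z = F a + ∫ t in a..z, f t)
    (hG : ∀ z ∈ uIcc a b, G z = G a + ∫ t in a..z, g t) :
    (∫ z in a..b, f z * G z) + ∫ z in a..b, F z * g z = F b * G b - F a * G a := by
  have hFac := absolutelyContinuousOnInterval_of_primitive hf hF
  have hGac := absolutelyContinuousOnInterval_of_primitive hg hG
  have hfG := hf.mul_continuousOn hGac.continuousOn
  have hFg := hg.continuousOn_mul hFac.continuousOn
  rw [← intervalIntegral.integral_add hfG hFg]
  refine integral_eq_sub_of_absolutelyContinuousOnInterval (hfG.add hFg) (hFac.smul hGac) ?_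
  filter_upwards [ae_hasDerivAt_of_primitive hf hF, ae_hasDerivAt_of_primitive hg hG]
    with z hz hz' hzm
  exact (hz hzm).mul (hz' hzm)

theorem ae_eq_zero_of_primitive_eq_zero [CompleteSpace E] (hf : IntervalIntegrable f volume a b)
    (h : ∀ z ∈ uIcc a b, ∫ t in a..z, f t = 0) : ∀ᵐ z, z ∈ uIoo a b → f z = 0 := by
  have hd := ae_hasDerivAt_of_primitive (F := fun _ => 0) hf (by simpa [eq_comm] using h)
  filter_upwards [hd] with z hz hzm
  exact (hz (uIoo_subset_uIcc_self hzm)).unique (hasDerivAt_const z 0)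

end AbsolutelyContinuous

section Gronwall

variable {a b : ℝ} {u w U : ℝ → ℝ}

theorem eqOn_zero_of_sub_le_integral_mul (hw : IntervalIntegrable w volume a b)
    (hUc : ContinuousOn U (Icc a b)) (hU0 : ∀ z ∈ Icc a b, 0 ≤ U z) (hUa : U a = 0)
    (h : ∀ x ∈ Icc a b, ∀ y ∈ Icc a b, x ≤ y → U y - U x ≤ (∫ t in x..y, w t) * U y) :
    EqOn U 0 (Icc a b) := by
  suffices Icc a b ⊆ {z | U z = 0} from this
  refine IsClosed.Icc_subset_of_forall_exists_gt ?_ hUa ?_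
  · rw [inter_comm]
    exact hUc.preimage_isClosed_of_isClosed isClosed_Icc isClosed_singleton
  rintro x ⟨hUx : U x = 0, hx⟩ y hxy
  have hab : uIcc a b = Icc a b := uIcc_of_le (hx.1.trans hx.2.le)
  have hxI : x ∈ Icc a b := Ico_subset_Icc_self hx
  have hsmall : ∀ᶠ z in 𝓝[>] x, ∫ t in x..z, w t < 1 := by
    have hc := intervalIntegral.continuousOn_primitive_interval' hw (hab.symm ▸ hxI)
    rw [hab] at hc
    exact ((hc x hxI).mono_of_mem_nhdsWithin (Icc_mem_nhdsGT_of_mem hx)).eventually_lt_const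
      (by simp)
  obtain ⟨z, hz1, hz⟩ := (hsmall.and (Ioc_mem_nhdsGT (lt_min hx.2 hxy))).exists
  have hzI : z ∈ Icc a b := ⟨hx.1.trans hz.1.le, hz.2.trans (min_le_left _ _)⟩
  refine ⟨z, show U z = 0 from le_antisymm ?_ (hU0 z hzI), hz.1, hz.2.trans (min_le_right _ _)⟩
  nlinarith [h x hxI z hzI hz.1.le, hU0 z hzI]

theorem eqOn_zero_of_le_integral_mul (hu : ContinuousOn u (Icc a b))
    (hw : IntervalIntegrable w volume a b) (hu0 : ∀ z ∈ Icc a b, 0 ≤ u z) (hw0 : 0 ≤ w)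
    (h : ∀ z ∈ Icc a b, u z ≤ ∫ t in a..z, w t * u t) : EqOn u 0 (Icc a b) := by
  rcases lt_or_ge b a with hba | hab
  · simp [Icc_eq_empty_of_lt hba]
  have hI : uIcc a b = Icc a b := uIcc_of_le hab
  have haI : a ∈ Icc a b := left_mem_Icc.2 hab
  have hwu : IntervalIntegrable (fun t => w t * u t) volume a b := hw.mul_continuousOn (hI ▸ hu)
  have hsub : ∀ {x y}, x ∈ Icc a b → y ∈ Icc a b → uIcc x y ⊆ uIcc a b :=
    fun hx hy => hI ▸ uIcc_subset_Icc hx hy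
  set U : ℝ → ℝ := fun z => ∫ t in a..z, w t * u t
  have hUsub : ∀ x ∈ Icc a b, ∀ y ∈ Icc a b, U y - U x = ∫ t in x..y, w t * u t :=
    fun x hx y hy => intervalIntegral.integral_interval_sub_left
      (hwu.mono_set (hsub haI hy)) (hwu.mono_set (hsub haI hx))
  have hUmono : MonotoneOn U (Icc a b) := fun x hx y hy hxy => by
    rw [← sub_nonneg, hUsub x hx y hy]
    exact intervalIntegral.integral_nonneg hxy fun t ht =>
      mul_nonneg (hw0 t) (hu0 t ⟨hx.1.trans ht.1, ht.2.trans hy.2⟩)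
  have hU : EqOn U 0 (Icc a b) := by
    refine eqOn_zero_of_sub_le_integral_mul hw
      (hI ▸ intervalIntegral.continuousOn_primitive_interval' hwu left_mem_uIcc)
      (fun z hz => (hu0 z hz).trans (h z hz)) intervalIntegral.integral_same
      fun x hx y hy hxy => ?_
    rw [hUsub x hx y hy, ← intervalIntegral.integral_mul_const]
    refine intervalIntegral.integral_mono_on hxy (hwu.mono_set (hsub hx hy))
      ((hw.mono_set (hsub hx hy)).mul_const _) fun t ht => ?_
    have htI : t ∈ Icc a b := ⟨hx.1.trans ht.1, ht.2.trans hy.2⟩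
    exact mul_le_mul_of_nonneg_left ((h t htI).trans (hUmono htI hy ht.2)) (hw0 t)
  exact fun z hz => le_antisymm ((h z hz).trans_eq (hU hz)) (hu0 z hz)

end Gronwall

section UnitInterval

variable {E : Type*} [NormedAddCommGroup E] {f g : ℝ → E}

theorem integral_unitVol [NormedSpace ℝ E] (f : ℝ → E) :
    ∫ z, f z ∂unitVol = ∫ z in (0 : ℝ)..1, f z := by
  rw [intervalIntegral.integral_of_le zero_le_one, integral_Ioc_eq_integral_Ioo]

theorem intervalIntegrable_of_integrable_unitVol (hf : Integrable f unitVol) :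
    IntervalIntegrable f volume 0 1 :=
  (intervalIntegrable_iff_integrableOn_Ioo_of_le zero_le_one).2 hf

theorem intervalIntegrable_left_of_integrable_unitVol (hf : Integrable f unitVol) {z : ℝ}
    (hz : z ∈ Icc (0 : ℝ) 1) : IntervalIntegrable f volume 0 z :=
  (intervalIntegrable_of_integrable_unitVol hf).mono_set
    (uIcc_subset_uIcc_left (uIcc_of_le (zero_le_one' ℝ) ▸ hz))

theorem memLp_unitVol_of_continuousOn (hf : ContinuousOn f (Icc 0 1)) (p : ENNReal) :
    MemLp f p unitVol := by
  obtain ⟨C, hC⟩ := isCompact_Icc.exists_bound_of_continuousOn hf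
  refine MemLp.of_bound (hf.aestronglyMeasurable_of_subset_isCompact isCompact_Icc
    measurableSet_Ioo Ioo_subset_Icc_self) C ?_
  filter_upwards [ae_restrict_mem measurableSet_Ioo] with z hz
  exact hC z (Ioo_subset_Icc_self hz)

theorem eqOn_Icc_of_ae_eq_unitVol (hf : ContinuousOn f (Icc 0 1)) (hg : ContinuousOn g (Icc 0 1))
    (h : f =ᵐ[unitVol] g) : EqOn f g (Icc 0 1) :=
  Measure.eqOn_Icc_of_ae_eq volume zero_ne_one (by rwa [← restrict_Ioo_eq_restrict_Icc]) hf hg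

theorem continuousOn_of_primitive [NormedSpace ℝ E] (hf : Integrable f unitVol)
    (hg : ∀ z ∈ Icc (0 : ℝ) 1, g z = g 0 + ∫ t in (0 : ℝ)..z, f t) :
    ContinuousOn g (Icc 0 1) := by
  have hc := intervalIntegral.continuousOn_primitive_interval'
    (intervalIntegrable_of_integrable_unitVol hf) left_mem_uIcc
  rw [uIcc_of_le zero_le_one] at hc
  exact (continuousOn_const.add hc).congr hg

theorem ae_eq_zero_of_primitive_eqOn_zero [NormedSpace ℝ E] [CompleteSpace E]
    (hf : Integrable f unitVol)
    (hg : ∀ z ∈ Icc (0 : ℝ) 1, g z = g 0 + ∫ t in (0 : ℝ)..z, f t) (hg0 : EqOn g 0 (Icc 0 1)) :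
    f =ᵐ[unitVol] 0 := by
  have h := ae_eq_zero_of_primitive_eq_zero (intervalIntegrable_of_integrable_unitVol hf)
    fun z hz => by
      rw [uIcc_of_le zero_le_one] at hz
      simpa [hg0 hz, hg0 (left_mem_Icc.2 zero_le_one)] using (hg z hz).symm
  rwa [uIoo_of_le zero_le_one, ← ae_restrict_iff' measurableSet_Ioo] at h

end UnitInterval

namespace IsSobolevH2

variable {h h₁ h₂ k k₁ k₂ : ℝ → ℂ}

theorem integrable_one (H : IsSobolevH2 h h₁ h₂) : Integrable h₁ unitVol :=
  H.memLp_one.integrable one_le_two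

theorem integrable_two (H : IsSobolevH2 h h₁ h₂) : Integrable h₂ unitVol :=
  H.memLp_two.integrable one_le_two

theorem continuousOn (H : IsSobolevH2 h h₁ h₂) : ContinuousOn h (Icc 0 1) :=
  continuousOn_of_primitive H.integrable_one H.primitive_one

theorem continuousOn_deriv (H : IsSobolevH2 h h₁ h₂) : ContinuousOn h₁ (Icc 0 1) :=
  continuousOn_of_primitive H.integrable_two H.primitive_two

theorem eqOn_zero_of_ae_eq_zero (H : IsSobolevH2 h h₁ h₂) (h0 : h =ᵐ[unitVol] 0) :
    EqOn h 0 (Icc 0 1) :=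
  eqOn_Icc_of_ae_eq_unitVol H.continuousOn continuousOn_const h0

theorem ae_eq_zero_two (H : IsSobolevH2 h h₁ h₂) (h0 : h =ᵐ[unitVol] 0) : h₂ =ᵐ[unitVol] 0 :=
  ae_eq_zero_of_primitive_eqOn_zero H.integrable_two H.primitive_two <|
    eqOn_Icc_of_ae_eq_unitVol H.continuousOn_deriv continuousOn_const <|
      ae_eq_zero_of_primitive_eqOn_zero H.integrable_one H.primitive_one <|
        H.eqOn_zero_of_ae_eq_zero h0

theorem green (H : IsSobolevH2 h h₁ h₂) (K : IsSobolevH2 k k₁ k₂) :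
    (∫ z, h₂ z * k z ∂unitVol) - (∫ z, h z * k₂ z ∂unitVol)
      = (h₁ 1 * k 1 - h 1 * k₁ 1) - (h₁ 0 * k 0 - h 0 * k₁ 0) := by
  have hI : uIcc (0 : ℝ) 1 = Icc 0 1 := uIcc_of_le zero_le_one
  have e₁ := integral_mul_add_mul_of_primitive
    (intervalIntegrable_of_integrable_unitVol H.integrable_two)
    (intervalIntegrable_of_integrable_unitVol K.integrable_one)
    (hI ▸ H.primitive_two) (hI ▸ K.primitive_one)
  have e₂ := integral_mul_add_mul_of_primitive
    (intervalIntegrable_of_integrable_unitVol H.integrable_one)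
    (intervalIntegrable_of_integrable_unitVol K.integrable_two)
    (hI ▸ H.primitive_one) (hI ▸ K.primitive_two)
  rw [integral_unitVol, integral_unitVol]
  linear_combination e₁ - e₂

theorem add (H : IsSobolevH2 h h₁ h₂) (K : IsSobolevH2 k k₁ k₂) :
    IsSobolevH2 (h + k) (h₁ + k₁) (h₂ + k₂) where
  memLp := H.memLp.add K.memLp
  memLp_one := H.memLp_one.add K.memLp_one
  memLp_two := H.memLp_two.add K.memLp_two
  primitive_one z hz := by
    simp only [Pi.add_apply]
    rw [intervalIntegral.integral_add, H.primitive_one z hz, K.primitive_one z hz,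
      add_add_add_comm]
    · exact intervalIntegrable_left_of_integrable_unitVol H.integrable_one hz
    · exact intervalIntegrable_left_of_integrable_unitVol K.integrable_one hz
  primitive_two z hz := by
    simp only [Pi.add_apply]
    rw [intervalIntegral.integral_add, H.primitive_two z hz, K.primitive_two z hz,
      add_add_add_comm]
    · exact intervalIntegrable_left_of_integrable_unitVol H.integrable_two hz
    · exact intervalIntegrable_left_of_integrable_unitVol K.integrable_two hz

theorem const_smul (H : IsSobolevH2 h h₁ h₂) (c : ℂ) :
    IsSobolevH2 (c • h) (c • h₁) (c • h₂) where
  memLp := H.memLp.const_smul c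
  memLp_one := H.memLp_one.const_smul c
  memLp_two := H.memLp_two.const_smul c
  primitive_one z hz := by
    simp only [Pi.smul_apply, intervalIntegral.integral_smul, ← smul_add, H.primitive_one z hz]
  primitive_two z hz := by
    simp only [Pi.smul_apply, intervalIntegral.integral_smul, ← smul_add, H.primitive_two z hz]

theorem star (H : IsSobolevH2 h h₁ h₂) : IsSobolevH2 (star h) (star h₁) (star h₂) where
  memLp := H.memLp.star
  memLp_one := H.memLp_one.star
  memLp_two := H.memLp_two.star
  primitive_one z hz := by
    simpa [intervalIntegral.integral_of_le hz.1, ← integral_conj] using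
      congrArg conj (H.primitive_one z hz)
  primitive_two z hz := by
    simpa [intervalIntegral.integral_of_le hz.1, ← integral_conj] using
      congrArg conj (H.primitive_two z hz)

theorem eqOn_zero_of_ae_eq_mul (H : IsSobolevH2 h h₁ h₂) {c : ℝ → ℂ} (hc : Integrable c unitVol)
    (hh : ∀ᵐ z ∂unitVol, h₂ z = c z * h z) (h0 : h 0 = 0) (h10 : h₁ 0 = 0) :
    EqOn h 0 (Icc 0 1) := by
  set u : ℝ → ℝ := fun z => ‖h z‖ + ‖h₁ z‖
  set w : ℝ → ℝ := fun z => 1 + ‖c z‖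
  have hu : ContinuousOn u (Icc 0 1) := H.continuousOn.norm.add H.continuousOn_deriv.norm
  have hw : Integrable w unitVol := (integrable_const 1).add hc.norm
  have hwu : Integrable (fun z => w z * u z) unitVol :=
    hw.mul_of_top_left (memLp_unitVol_of_continuousOn hu ⊤)
  have hle : ∀ z ∈ Icc (0 : ℝ) 1, u z ≤ ∫ t in (0 : ℝ)..z, w t * u t := by
    intro z hz
    have hi₁ := intervalIntegrable_left_of_integrable_unitVol H.integrable_one hz
    have hi₂ := intervalIntegrable_left_of_integrable_unitVol H.integrable_two hz
    calc u z ≤ (∫ t in (0 : ℝ)..z, ‖h₁ t‖) + ∫ t in (0 : ℝ)..z, ‖h₂ t‖ := by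
          refine add_le_add ?_ ?_
          · rw [H.primitive_one z hz, h0, zero_add]
            exact intervalIntegral.norm_integral_le_integral_norm hz.1
          · rw [H.primitive_two z hz, h10, zero_add]
            exact intervalIntegral.norm_integral_le_integral_norm hz.1
      _ = ∫ t in (0 : ℝ)..z, (‖h₁ t‖ + ‖h₂ t‖) :=
          (intervalIntegral.integral_add hi₁.norm hi₂.norm).symm
      _ ≤ ∫ t in (0 : ℝ)..z, w t * u t := by
          refine intervalIntegral.integral_mono_ae_restrict hz.1 (hi₁.norm.add hi₂.norm)
            (intervalIntegrable_left_of_integrable_unitVol hwu hz) ?_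
          rw [← restrict_Ioo_eq_restrict_Icc]
          filter_upwards [ae_mono (Measure.restrict_mono_set volume (Ioo_subset_Ioo_right hz.2)) hh]
            with t ht
          simp only [ht, norm_mul, w, u]
          nlinarith [norm_nonneg (h t), mul_nonneg (norm_nonneg (c t)) (norm_nonneg (h₁ t))]
  have hu0 := eqOn_zero_of_le_integral_mul hu (intervalIntegrable_of_integrable_unitVol hw)
    (fun z _ => by positivity) (fun z => by positivity) hle
  exact fun z hz => norm_eq_zero.1 (le_antisymm
    ((le_add_of_nonneg_right (norm_nonneg _)).trans_eq (hu0 hz)) (norm_nonneg _))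

end IsSobolevH2

namespace SLGraph

variable {ρ : ℝ} {a : ℝ → ℝ} {q₀ q₁ : ℝ} {h g k l : ℝ → ℂ} {μ : ℂ}

theorem continuousOn (H : SLGraph ρ a q₀ q₁ h g) : ContinuousOn h (Icc 0 1) := by
  obtain ⟨_, _, H, -⟩ := H
  exact H.continuousOn

theorem memLp_top (H : SLGraph ρ a q₀ q₁ h g) : MemLp h ⊤ unitVol :=
  memLp_unitVol_of_continuousOn H.continuousOn ⊤

theorem congr_ae (H : SLGraph ρ a q₀ q₁ h g) (hg : k =ᵐ[unitVol] g) : SLGraph ρ a q₀ q₁ h k := by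
  obtain ⟨h₁, h₂, H, b0, b1, he⟩ := H
  exact ⟨h₁, h₂, H, b0, b1, hg.trans he⟩

theorem add (H : SLGraph ρ a q₀ q₁ h g) (K : SLGraph ρ a q₀ q₁ k l) :
    SLGraph ρ a q₀ q₁ (h + k) (g + l) := by
  obtain ⟨h₁, h₂, H, b0, b1, he⟩ := H
  obtain ⟨k₁, k₂, K, c0, c1, ke⟩ := K
  refine ⟨_, _, H.add K, ?_, ?_, ?_⟩
  · simp only [Pi.add_apply, b0, c0, mul_add]
  · simp only [Pi.add_apply, b1, c1, mul_add]
  · filter_upwards [he, ke] with z hz kz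
    simp only [Pi.add_apply, hz, kz]
    ring

theorem const_smul (H : SLGraph ρ a q₀ q₁ h g) (c : ℂ) :
    SLGraph ρ a q₀ q₁ (c • h) (c • g) := by
  obtain ⟨h₁, h₂, H, b0, b1, he⟩ := H
  refine ⟨_, _, H.const_smul c, ?_, ?_, ?_⟩
  · simp only [Pi.smul_apply, smul_eq_mul, b0, mul_left_comm]
  · simp only [Pi.smul_apply, smul_eq_mul, b1, mul_left_comm]
  · filter_upwards [he] with z hz
    simp only [Pi.smul_apply, smul_eq_mul, hz]
    ring

theorem star (H : SLGraph ρ a q₀ q₁ h g) : SLGraph ρ a q₀ q₁ (star h) (star g) := by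
  obtain ⟨h₁, h₂, H, b0, b1, he⟩ := H
  refine ⟨_, _, H.star, ?_, ?_, ?_⟩
  · simp [b0]
  · simp [b1]
  · filter_upwards [he] with z hz
    simp [hz]

theorem sub_potential (H : SLGraph ρ a q₀ q₁ h g) (κ : ℝ) :
    SLGraph ρ (fun z => a z - κ) q₀ q₁ h (fun z => g z - κ * h z) := by
  obtain ⟨h₁, h₂, H, b0, b1, he⟩ := H
  refine ⟨h₁, h₂, H, b0, b1, ?_⟩
  filter_upwards [he] with z hz
  push_cast
  linear_combination hz

theorem green {h₁ h₂ : ℝ → ℂ} (H : IsSobolevH2 h h₁ h₂) (K : SLGraph ρ a q₀ q₁ k l) :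
    ∫ z, ((ρ * h₂ z + a z * h z) * k z - h z * l z) ∂unitVol
      = ρ * ((h₁ 1 - q₁ * h 1) * k 1 - (h₁ 0 - q₀ * h 0) * k 0) := by
  obtain ⟨k₁, k₂, K, c0, c1, ke⟩ := K
  have hint₁ : Integrable (fun z => h₂ z * k z) unitVol :=
    H.integrable_two.mul_of_top_left (memLp_unitVol_of_continuousOn K.continuousOn ⊤)
  have hint₂ : Integrable (fun z => h z * k₂ z) unitVol :=
    K.integrable_two.mul_of_top_right (memLp_unitVol_of_continuousOn H.continuousOn ⊤)
  calc ∫ z, ((ρ * h₂ z + a z * h z) * k z - h z * l z) ∂unitVol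
      = ∫ z, (ρ : ℂ) * (h₂ z * k z - h z * k₂ z) ∂unitVol := by
        refine integral_congr_ae ?_
        filter_upwards [ke] with z hz
        rw [hz]
        ring
    _ = ρ * ((h₁ 1 * k 1 - h 1 * k₁ 1) - (h₁ 0 * k 0 - h 0 * k₁ 0)) := by
        rw [integral_const_mul, integral_sub hint₁ hint₂, H.green K]
    _ = _ := by rw [c0, c1]; ring

theorem integral_mul_comm (H : SLGraph ρ a q₀ q₁ h g) (K : SLGraph ρ a q₀ q₁ k l)
    (hg : Integrable g unitVol) (hl : Integrable l unitVol) :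
    ∫ z, g z * k z ∂unitVol = ∫ z, h z * l z ∂unitVol := by
  have hgk : Integrable (fun z => g z * k z) unitVol := hg.mul_of_top_left K.memLp_top
  have hhl : Integrable (fun z => h z * l z) unitVol := hl.mul_of_top_right H.memLp_top
  rw [← sub_eq_zero, ← integral_sub hgk hhl]
  obtain ⟨h₁, h₂, H, b0, b1, he⟩ := H
  calc ∫ z, (g z * k z - h z * l z) ∂unitVol
      = ∫ z, ((ρ * h₂ z + a z * h z) * k z - h z * l z) ∂unitVol :=
        integral_congr_ae (by filter_upwards [he] with z hz; rw [hz])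
    _ = 0 := by rw [green H K, b0, b1]; ring

theorem ae_eq_zero (H : SLGraph ρ a q₀ q₁ h g) (h0 : h =ᵐ[unitVol] 0) : g =ᵐ[unitVol] 0 := by
  obtain ⟨h₁, h₂, H, -, -, he⟩ := H
  filter_upwards [he, h0, H.ae_eq_zero_two h0] with z hz hz0 hz2
  simp [hz, hz0, hz2]

theorem ae_eq_of_not_isEigenpair (h0 : ∀ u, ¬ IsEigenpair ρ a q₀ q₁ 0 u)
    (H : SLGraph ρ a q₀ q₁ h g) (K : SLGraph ρ a q₀ q₁ k g) : h =ᵐ[unitVol] k := by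
  have W : SLGraph ρ a q₀ q₁ (h + (-1 : ℂ) • k) fun z => 0 * (h + (-1 : ℂ) • k) z :=
    (H.add (K.const_smul (-1))).congr_ae (.of_forall fun z => by simp)
  filter_upwards [of_not_not fun hne => h0 _ ⟨W, hne⟩] with z hz
  simpa [add_neg_eq_zero] using hz

theorem eqOn_zero_of_eigen (hρ : ρ ≠ 0) (ha : Integrable a unitVol)
    (H : SLGraph ρ a q₀ q₁ h fun z => μ * h z) (h0 : h 0 = 0) : EqOn h 0 (Icc 0 1) := by
  obtain ⟨h₁, h₂, H, b0, -, he⟩ := H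
  have hρ' : (ρ : ℂ) ≠ 0 := Complex.ofReal_ne_zero.2 hρ
  refine H.eqOn_zero_of_ae_eq_mul (c := fun z => (μ - a z) / ρ)
    (((integrable_const μ).sub ha.ofReal).div_const _) ?_ h0 (by rw [b0, h0, mul_zero])
  filter_upwards [he] with z hz
  field_simp
  linear_combination -hz

theorem smul_eqOn_smul_of_eigen (hρ : ρ ≠ 0) (ha : Integrable a unitVol)
    (H : SLGraph ρ a q₀ q₁ h fun z => μ * h z) (K : SLGraph ρ a q₀ q₁ k fun z => μ * k z) :
    EqOn (k 0 • h) (h 0 • k) (Icc 0 1) := by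
  have W := (H.const_smul (k 0)).add (K.const_smul (-h 0))
  have hW := eqOn_zero_of_eigen hρ ha (μ := μ) (W.congr_ae (.of_forall fun z => by
    simp only [Pi.add_apply, Pi.smul_apply, smul_eq_mul]
    ring)) (by simp [mul_comm])
  intro z hz
  simpa [add_neg_eq_zero] using hW hz

end SLGraph

theorem IsEigenpair.apply_zero_ne_zero {ρ : ℝ} {a : ℝ → ℝ} {q₀ q₁ : ℝ} {h : ℝ → ℂ} {μ : ℂ}
    (hρ : ρ ≠ 0) (ha : Integrable a unitVol) (H : IsEigenpair ρ a q₀ q₁ μ h) : h 0 ≠ 0 := by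
  intro h0
  refine H.2 ?_
  filter_upwards [ae_restrict_mem measurableSet_Ioo] with z hz
  exact H.1.eqOn_zero_of_eigen hρ ha h0 (Ioo_subset_Icc_self hz)

section CompactOperator

variable {𝕜 E F : Type*} [NormedAddCommGroup E] [NormedAddCommGroup F]

theorem isCompactOperator_smulRight [NontriviallyNormedField 𝕜] [LocallyCompactSpace 𝕜]
    [NormedSpace 𝕜 E] [NormedSpace 𝕜 F] (f : E →L[𝕜] 𝕜) (x : F) :
    IsCompactOperator (f.smulRight x) :=
  (isCompactOperator_of_locallyCompactSpace_rng
    (ContinuousLinearMap.toSpanSingleton 𝕜 x)).comp_clm f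

theorem exists_equiv_one_add_of_isCompactOperator [NontriviallyNormedField 𝕜] [NormedSpace 𝕜 E]
    [CompleteSpace E] {K : E →L[𝕜] E} (hK : IsCompactOperator K)
    (hinj : ∀ x, x + K x = 0 → x = 0) : ∃ e : E ≃L[𝕜] E, ∀ x, e x = x + K x := by
  rcases hK.hasEigenvalue_or_mem_resolventSet (μ := (-1 : 𝕜)) (by norm_num) with h | h
  · obtain ⟨x, hx⟩ := h.exists_hasEigenvector
    have hKx : K x = -x := by simpa using hx.apply_eq_smul
    exact absurd (hinj x (by rw [hKx, add_neg_cancel])) hx.2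
  · have hu : IsUnit (1 + K) := by
      rw [spectrum.mem_resolventSet_iff] at h
      simpa [add_comm] using h.neg
    obtain ⟨u, hu⟩ := hu
    exact ⟨ContinuousLinearEquiv.unitsEquiv 𝕜 E u, fun x => by
      simp [ContinuousLinearEquiv.unitsEquiv_apply, hu]⟩

variable [RCLike 𝕜] [NormedSpace 𝕜 E] {α : Type*} [MeasurableSpace α] {μ : Measure α}
  {p : ENNReal} [Fact (1 ≤ p)]

/-- The operator `x ↦ (z ↦ κ z x)` from `E` to `Lᵖ` with the kernel `κ`, an `Lᵖ` family of bounded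
functionals on `E`, as a bounded linear function of `κ`. -/
noncomputable def functionalKernel :
    Lp (E →L[𝕜] 𝕜) p μ →L[𝕜] E →L[𝕜] Lp 𝕜 p μ :=
  ((ContinuousLinearMap.apply 𝕜 𝕜).compLpL₂ p μ).flip

theorem functionalKernel_apply_ae (κ : Lp (E →L[𝕜] 𝕜) p μ) (x : E) :
    functionalKernel κ x =ᵐ[μ] fun z => κ z x :=
  (ContinuousLinearMap.apply 𝕜 𝕜 x).coeFn_compLp κ

theorem functionalKernel_toLp_apply_ae {κ : α → E →L[𝕜] 𝕜} (hκ : MemLp κ p μ) (x : E) :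
    functionalKernel hκ.toLp x =ᵐ[μ] fun z => κ z x := by
  filter_upwards [functionalKernel_apply_ae hκ.toLp x, hκ.coeFn_toLp] with z h₁ h₂
  rw [h₁, h₂]

theorem functionalKernel_indicatorConstLp {s : Set α} (hs : MeasurableSet s) (hμs : μ s ≠ ⊤)
    (f : E →L[𝕜] 𝕜) :
    functionalKernel (indicatorConstLp p hs hμs f) =
      f.smulRight (indicatorConstLp p hs hμs (1 : 𝕜)) := by
  ext1 x
  refine Lp.ext ?_
  filter_upwards [functionalKernel_apply_ae (indicatorConstLp p hs hμs f) x,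
    indicatorConstLp_coeFn (p := p) (hs := hs) (hμs := hμs) (c := f),
    indicatorConstLp_coeFn (p := p) (hs := hs) (hμs := hμs) (c := (1 : 𝕜)),
    Lp.coeFn_smul (f x) (indicatorConstLp p hs hμs (1 : 𝕜))] with z h₁ h₂ h₃ h₄
  by_cases hz : z ∈ s <;> simp_all

theorem isCompactOperator_functionalKernel (hp : p ≠ ⊤) (κ : Lp (E →L[𝕜] 𝕜) p μ) :
    IsCompactOperator (functionalKernel κ) := by
  induction κ using Lp.induction hp with
  | indicatorConst f hs hμs =>
    rw [Lp.simpleFunc.coe_indicatorConst, functionalKernel_indicatorConstLp]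
    exact isCompactOperator_smulRight f _
  | add hf hg _ hκf hκg =>
    rw [map_add]
    exact hκf.add hκg
  | isClosed =>
    exact IsClosed.preimage functionalKernel.continuous
      (isClosed_setOfPred_isCompactOperator (σ₁₂ := RingHom.id 𝕜))

end CompactOperator

theorem tendsto_apply_of_orthonormal {𝕜 E F : Type*} [RCLike 𝕜] [NormedAddCommGroup E]
    [InnerProductSpace 𝕜 E] [CompleteSpace E] [NormedAddCommGroup F] [InnerProductSpace 𝕜 F]
    [CompleteSpace F] {T : E →L[𝕜] F} (hT : IsCompactOperator T) {e : ℕ → E}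
    (he : Orthonormal 𝕜 e) : Tendsto (fun i => T (e i)) atTop (𝓝 0) := by
  have hweak : ∀ x, Tendsto (fun i => inner 𝕜 (e i) x) atTop (𝓝 0) := fun x =>
    squeeze_zero_norm (fun i => Real.le_sqrt_of_sq_le le_rfl)
      (by simpa using (he.inner_products_summable (x := x)).tendsto_atTop_zero.sqrt)
  obtain ⟨S, hS, hTS⟩ := IsCompactOperator.image_closedBall_subset_compact hT 1
  refine tendsto_of_subseq_tendsto fun ns hns => ?_
  obtain ⟨y, -, ms, hms, hy⟩ :=
    hS.tendsto_subseq fun i => hTS ⟨e (ns i), by simp [he.1 (ns i)], rfl⟩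
  suffices y = 0 from ⟨ms, this ▸ hy⟩
  have h₁ : Tendsto (fun i => inner 𝕜 (T (e (ns (ms i)))) y) atTop (𝓝 (inner 𝕜 y y)) :=
    hy.inner tendsto_const_nhds
  have h₂ := (hweak (T.adjoint y)).comp (hns.comp hms.tendsto_atTop)
  simp only [Function.comp_def, ContinuousLinearMap.adjoint_inner_right] at h₂
  exact inner_self_eq_zero.1 (tendsto_nhds_unique h₁ h₂)

section InitialValueProblem

variable {ρ : ℝ} {a : ℝ → ℝ} {q₀ q₁ : ℝ}

/-- The functional `f ↦ ∫₀ᶻ f` on `L₂(0,1)`, for `z ∈ [0,1]`. -/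
noncomputable def primitiveFunctional (z : ℝ) : StateSpace →L[ℂ] ℂ :=
  innerSL ℂ (indicatorConstLp 2 (measurableSet_Ioo (a := 0) (b := z)) (measure_ne_top unitVol _)
    (1 : ℂ))

theorem continuous_primitiveFunctional : Continuous primitiveFunctional := by
  refine (innerSL ℂ).continuous.comp
    (continuous_indicatorConstLp_set ENNReal.ofNat_ne_top fun x => ?_)
  have hlim : Tendsto (fun y => ENNReal.ofReal |y - x|) (𝓝 x) (𝓝 0) := by
    have hc : Continuous fun y => ENNReal.ofReal |y - x| :=
      ENNReal.continuous_ofReal.comp (by fun_prop)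
    simpa using hc.tendsto x
  refine tendsto_of_tendsto_of_tendsto_of_le_of_le tendsto_const_nhds hlim
    (fun _ => zero_le) fun y => ?_
  calc unitVol (symmDiff (Ioo 0 y) (Ioo 0 x)) ≤ volume (symmDiff (Ioo 0 y) (Ioo 0 x)) :=
        Measure.restrict_apply_le _ _
    _ ≤ volume (uIcc x y) := by
        refine measure_mono fun z hz => ?_
        simp only [mem_symmDiff, mem_Ioo, mem_uIcc] at hz ⊢
        grind
    _ = ENNReal.ofReal |y - x| := Real.volume_interval

theorem primitiveFunctional_apply {z : ℝ} (hz : z ∈ Icc (0 : ℝ) 1) (f : StateSpace) :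
    primitiveFunctional z f = ∫ t in (0 : ℝ)..z, f t := by
  rw [primitiveFunctional, innerSL_apply_apply, L2.inner_indicatorConstLp_one,
    Measure.restrict_restrict measurableSet_Ioo,
    inter_eq_self_of_subset_left (Ioo_subset_Ioo_right hz.2),
    intervalIntegral.integral_of_le hz.1, integral_Ioc_eq_integral_Ioo]

/-- The value `h'(z)` for the solution of `h'' = f`, `h(0) = c`, `h'(0) = q c`, as a functional of
the data `(c, f)`. -/
noncomputable def derivFunctional (q z : ℝ) : ℂ × StateSpace →L[ℂ] ℂ :=
  (q : ℂ) • ContinuousLinearMap.fst ℂ ℂ StateSpace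
    + primitiveFunctional z ∘L ContinuousLinearMap.snd ℂ ℂ StateSpace

/-- The value `h(z)` for the solution of `h'' = f`, `h(0) = c`, `h'(0) = q c`, as a functional of
the data `(c, f)`. -/
noncomputable def evalFunctional (q z : ℝ) : ℂ × StateSpace →L[ℂ] ℂ :=
  ContinuousLinearMap.fst ℂ ℂ StateSpace + ∫ t in (0 : ℝ)..z, derivFunctional q t

theorem continuous_derivFunctional (q : ℝ) : Continuous (derivFunctional q) :=
  continuous_const.add (continuous_primitiveFunctional.clm_comp continuous_const)

theorem continuous_evalFunctional (q : ℝ) : Continuous (evalFunctional q) :=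
  continuous_const.add (intervalIntegral.continuous_primitive
    (fun _ _ => (continuous_derivFunctional q).intervalIntegrable _ _) 0)

theorem derivFunctional_apply (q : ℝ) {z : ℝ} (hz : z ∈ Icc (0 : ℝ) 1) (x : ℂ × StateSpace) :
    derivFunctional q z x = q * x.1 + ∫ t in (0 : ℝ)..z, x.2 t := by
  simp [derivFunctional, primitiveFunctional_apply hz]

theorem evalFunctional_apply (q z : ℝ) (x : ℂ × StateSpace) :
    evalFunctional q z x = x.1 + ∫ t in (0 : ℝ)..z, derivFunctional q t x := by
  simp [evalFunctional, ContinuousLinearMap.intervalIntegral_apply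
    ((continuous_derivFunctional q).intervalIntegrable 0 z) x]

theorem memLp_evalFunctional (q : ℝ) (p : ENNReal) : MemLp (evalFunctional q) p unitVol :=
  memLp_unitVol_of_continuousOn (continuous_evalFunctional q).continuousOn p

theorem memLp_mul_evalFunctional (ha : MemLp a 2 unitVol) (ρ q : ℝ) :
    MemLp (fun z => (a z / ρ : ℂ) • evalFunctional q z) 2 unitVol := by
  have ha' : MemLp (fun z => (a z / ρ : ℂ)) 2 unitVol := by
    simpa only [div_eq_inv_mul] using! ha.ofReal.const_mul (ρ : ℂ)⁻¹
  exact (memLp_evalFunctional q ⊤).smul ha'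

theorem isSobolevH2_evalFunctional (q : ℝ) (x : ℂ × StateSpace) :
    IsSobolevH2 (fun z => evalFunctional q z x) (fun z => derivFunctional q z x) x.2 where
  memLp := memLp_unitVol_of_continuousOn
    ((continuous_evalFunctional q).clm_apply continuous_const).continuousOn 2
  memLp_one := memLp_unitVol_of_continuousOn
    ((continuous_derivFunctional q).clm_apply continuous_const).continuousOn 2
  memLp_two := Lp.memLp x.2
  primitive_one z _ := by simp [evalFunctional_apply]
  primitive_two z hz := by
    simp [derivFunctional_apply q hz, derivFunctional_apply q (left_mem_Icc.2 zero_le_one)]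

theorem slGraph_evalFunctional {x : ℂ × StateSpace} {g : ℝ → ℂ}
    (hb : derivFunctional q₀ 1 x - q₁ * evalFunctional q₀ 1 x = 0)
    (hg : ∀ᵐ z ∂unitVol, g z = ρ * x.2 z + a z * evalFunctional q₀ z x) :
    SLGraph ρ a q₀ q₁ (fun z => evalFunctional q₀ z x) g :=
  ⟨_, _, isSobolevH2_evalFunctional q₀ x,
    by simp [evalFunctional_apply, derivFunctional_apply q₀ (left_mem_Icc.2 zero_le_one)],
    sub_eq_zero.1 hb, hg⟩

theorem eq_zero_of_evalFunctional_ae_eq_zero {q : ℝ} {x : ℂ × StateSpace}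
    (hx : (fun z => evalFunctional q z x) =ᵐ[unitVol] 0) : x = 0 := by
  have H := isSobolevH2_evalFunctional q x
  refine Prod.ext ?_ ((Lp.eq_zero_iff_ae_eq_zero).2 (H.ae_eq_zero_two hx))
  simpa [evalFunctional_apply] using H.eqOn_zero_of_ae_eq_zero hx (left_mem_Icc.2 zero_le_one)

theorem exists_equiv_boundaryValueProblem (hρ : ρ ≠ 0) (ha : MemLp a 2 unitVol)
    (h0 : ∀ h, ¬ IsEigenpair ρ a q₀ q₁ 0 h) :
    ∃ e : (ℂ × StateSpace) ≃L[ℂ] ℂ × StateSpace, ∀ x,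
      (e x).1 = derivFunctional q₀ 1 x - q₁ * evalFunctional q₀ 1 x ∧
      ∀ᵐ z ∂unitVol, ρ * (e x).2 z = ρ * x.2 z + a z * evalFunctional q₀ z x := by
  have hρ' : (ρ : ℂ) ≠ 0 := Complex.ofReal_ne_zero.2 hρ
  have hm := memLp_mul_evalFunctional ha ρ q₀
  set b : ℂ × StateSpace →L[ℂ] ℂ := derivFunctional q₀ 1 - (q₁ : ℂ) • evalFunctional q₀ 1
    - ContinuousLinearMap.fst ℂ ℂ StateSpace
  set M : ℂ × StateSpace →L[ℂ] StateSpace := functionalKernel hm.toLp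
  have hM : IsCompactOperator M := isCompactOperator_functionalKernel ENNReal.ofNat_ne_top _
  set K : ℂ × StateSpace →L[ℂ] ℂ × StateSpace := b.smulRight ((1, 0) : ℂ × StateSpace)
    + ContinuousLinearMap.inr ℂ ℂ StateSpace ∘L M
  have hK : IsCompactOperator K := (isCompactOperator_smulRight _ _).add
    (hM.clm_comp (ContinuousLinearMap.inr ℂ ℂ StateSpace))
  have hfst : ∀ x, (x + K x).1 = derivFunctional q₀ 1 x - q₁ * evalFunctional q₀ 1 x := by
    simp [K, b]
  have hsnd : ∀ x, ∀ᵐ z ∂unitVol,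
      ρ * (x + K x).2 z = ρ * x.2 z + a z * evalFunctional q₀ z x := fun x => by
    have hKx : (x + K x).2 = x.2 + M x := by simp [K]
    rw [hKx]
    filter_upwards [Lp.coeFn_add x.2 (M x),
      functionalKernel_toLp_apply_ae hm x] with z h₁ h₂
    rw [h₁, Pi.add_apply, h₂, smul_apply, smul_eq_mul]
    field_simp
  obtain ⟨e, he⟩ := exists_equiv_one_add_of_isCompactOperator hK fun x hx => by
    have hG : SLGraph ρ a q₀ q₁ (fun z => evalFunctional q₀ z x) fun z =>
        0 * evalFunctional q₀ z x := by
      refine slGraph_evalFunctional (by rw [← hfst, hx, Prod.fst_zero]) ?_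
      filter_upwards [hsnd x, Lp.coeFn_zero ℂ 2 unitVol] with z hz hz0
      rw [← hz, hx, Prod.snd_zero, hz0, Pi.zero_apply, mul_zero, zero_mul]
    exact eq_zero_of_evalFunctional_ae_eq_zero (by_contra fun hne => h0 _ ⟨hG, hne⟩)
  exact ⟨e, fun x => by rw [he]; exact ⟨hfst x, hsnd x⟩⟩

end InitialValueProblem

/-- `T` is a right inverse on `L₂(0,1)` of the operator `𝒜`: `T f` lies in its domain and is
mapped to `f`. -/
def IsSLInverse (ρ : ℝ) (a : ℝ → ℝ) (q₀ q₁ : ℝ) (T : StateSpace →L[ℂ] StateSpace) : Prop :=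
  ∀ f : StateSpace, ∃ h : ℝ → ℂ, h =ᵐ[unitVol] T f ∧ SLGraph ρ a q₀ q₁ h f

theorem exists_isSLInverse_isCompactOperator {ρ : ℝ} (hρ : ρ ≠ 0) {a : ℝ → ℝ}
    (ha : MemLp a 2 unitVol) {q₀ q₁ : ℝ} (h0 : ∀ h, ¬ IsEigenpair ρ a q₀ q₁ 0 h) :
    ∃ T, IsSLInverse ρ a q₀ q₁ T ∧ IsCompactOperator T := by
  have hρ' : (ρ : ℂ) ≠ 0 := Complex.ofReal_ne_zero.2 hρ
  obtain ⟨e, he⟩ := exists_equiv_boundaryValueProblem hρ ha h0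
  let S : StateSpace →L[ℂ] ℂ × StateSpace :=
    (e.symm : ℂ × StateSpace →L[ℂ] ℂ × StateSpace) ∘L
      ((ρ : ℂ)⁻¹ • ContinuousLinearMap.inr ℂ ℂ StateSpace)
  let Ψ : ℂ × StateSpace →L[ℂ] StateSpace := functionalKernel (memLp_evalFunctional q₀ 2).toLp
  have hΨ : IsCompactOperator Ψ := isCompactOperator_functionalKernel ENNReal.ofNat_ne_top _
  refine ⟨Ψ ∘L S, fun f => ⟨fun z => evalFunctional q₀ z (S f),
    (functionalKernel_toLp_apply_ae _ _).symm, ?_⟩, hΨ.comp_clm S⟩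
  have heS : e (S f) = (0, (ρ : ℂ)⁻¹ • f) := by simp [S]
  obtain ⟨hb, hf⟩ := he (S f)
  rw [heS] at hb hf
  refine slGraph_evalFunctional hb.symm ?_
  filter_upwards [hf, Lp.coeFn_smul (ρ : ℂ)⁻¹ f] with z hz hsmul
  rw [← hz, hsmul, Pi.smul_apply, smul_eq_mul, mul_inv_cancel_left₀ hρ']

namespace IsSLInverse

variable {ρ : ℝ} {a : ℝ → ℝ} {q₀ q₁ : ℝ} {T : StateSpace →L[ℂ] StateSpace}

theorem isSymmetric (hT : IsSLInverse ρ a q₀ q₁ T) : T.IsSymmetric := by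
  intro f g
  obtain ⟨h, hf, H⟩ := hT f
  obtain ⟨k, hg, K⟩ := hT g
  calc inner ℂ (T f) g = ∫ z, star h z * g z ∂unitVol := by
        rw [L2.inner_def]
        refine integral_congr_ae ?_
        filter_upwards [hf] with z hz
        rw [RCLike.inner_apply', ← hz]
        rfl
    _ = ∫ z, star (f : ℝ → ℂ) z * k z ∂unitVol :=
        (H.star.integral_mul_comm K ((Lp.memLp f).star.integrable one_le_two)
          ((Lp.memLp g).integrable one_le_two)).symm
    _ = inner ℂ f (T g) := by
        rw [L2.inner_def]
        refine integral_congr_ae ?_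
        filter_upwards [hg] with z hz
        rw [RCLike.inner_apply', ← hz]
        rfl

theorem injective (hT : IsSLInverse ρ a q₀ q₁ T) : Function.Injective T := by
  refine (injective_iff_map_eq_zero T).2 fun f hf => ?_
  obtain ⟨h, hh, H⟩ := hT f
  rw [hf] at hh
  exact (Lp.eq_zero_iff_ae_eq_zero).2 (H.ae_eq_zero (hh.trans (Lp.coeFn_zero ℂ 2 unitVol)))

theorem apply_eq_of_slGraph (hT : IsSLInverse ρ a q₀ q₁ T)
    (h0 : ∀ u, ¬ IsEigenpair ρ a q₀ q₁ 0 u) {f g : StateSpace} {h : ℝ → ℂ}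
    (H : SLGraph ρ a q₀ q₁ h g) (hf : f =ᵐ[unitVol] h) : T g = f := by
  obtain ⟨k, hk, K⟩ := hT g
  exact Lp.ext ((hk.symm.trans (K.ae_eq_of_not_isEigenpair h0 H)).trans hf.symm)

theorem exists_isEigenpair_of_apply_eq_smul (hT : IsSLInverse ρ a q₀ q₁ T) {f : StateSpace} {μ : ℂ}
    (hf : T f = μ • f) (hf0 : f ≠ 0) :
    ∃ h : ℝ → ℂ, f =ᵐ[unitVol] h ∧ IsEigenpair ρ a q₀ q₁ μ⁻¹ h := by
  have hμ : μ ≠ 0 := by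
    rintro rfl
    exact hf0 ((injective_iff_map_eq_zero T).1 hT.injective f (by rw [hf, zero_smul]))
  obtain ⟨h, hh, H⟩ := hT f
  have hfh : f =ᵐ[unitVol] μ⁻¹ • h := by
    filter_upwards [hh, Lp.coeFn_smul μ f] with z hz hsmul
    rw [Pi.smul_apply, hz, hf, hsmul, Pi.smul_apply, inv_smul_smul₀ hμ]
  refine ⟨_, hfh, (H.const_smul μ⁻¹).congr_ae ?_,
    fun h0 => hf0 (Lp.eq_zero_iff_ae_eq_zero.2 (hfh.trans h0))⟩
  filter_upwards [hfh] with z hz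
  rw [← hz, Pi.smul_apply, smul_eq_mul]

end IsSLInverse

namespace IsEigensystem

variable {ρ : ℝ} {a : ℝ → ℝ} {q₀ q₁ : ℝ} {lam : ℕ → ℝ} {φ : ℕ → ℝ → ℝ}
  (hs : IsEigensystem ρ a q₀ q₁ lam φ)

include hs

theorem sub_potential (κ : ℝ) :
    IsEigensystem ρ (fun z => a z - κ) q₀ q₁ (fun i => lam i - κ) φ where
  strictAnti i j hij := sub_lt_sub_right (hs.strictAnti hij) κ
  exhaustive μ := by
    rintro ⟨h, H, h0⟩
    have H' := (H.sub_potential (-κ)).congr_ae (k := fun z => ((μ + κ : ℝ) : ℂ) * h z)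
      (.of_forall fun z => by push_cast; ring)
    simp only [sub_neg_eq_add, sub_add_cancel] at H'
    obtain ⟨i, hi⟩ := hs.exhaustive _ ⟨h, H', h0⟩
    exact ⟨i, by rw [hi, add_sub_cancel_right]⟩
  eigen i := ⟨((hs.eigen i).1.sub_potential κ).congr_ae (.of_forall fun z => by push_cast; ring),
    (hs.eigen i).2⟩
  normalized := hs.normalized

theorem not_isEigenpair_of_lt {μ : ℝ} (hμ : lam 0 < μ) (h : ℝ → ℂ) :
    ¬ IsEigenpair ρ a q₀ q₁ μ h := by
  intro H
  obtain ⟨i, rfl⟩ := hs.exhaustive _ ⟨h, H⟩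
  exact hμ.not_ge (hs.strictAnti.antitone (Nat.zero_le i))

theorem not_isEigenpair_zero (h0 : lam 0 < 0) (h : ℝ → ℂ) : ¬ IsEigenpair ρ a q₀ q₁ 0 h := by
  simpa using hs.not_isEigenpair_of_lt h0 h

theorem vec_coeFn (i : ℕ) : hs.vec i =ᵐ[unitVol] fun z => (φ i z : ℂ) :=
  (hs.memLp i).coeFn_toLp

theorem integrable_const_mul (i : ℕ) (c : ℂ) : Integrable (fun z => c * (φ i z : ℂ)) unitVol :=
  ((hs.memLp i).integrable one_le_two).const_mul c

theorem inner_vec_toLp (i : ℕ) {h : ℝ → ℂ} (hh : MemLp h 2 unitVol) :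
    inner ℂ (hs.vec i) hh.toLp = ∫ z, h z * φ i z ∂unitVol := by
  rw [L2.inner_def]
  refine integral_congr_ae ?_
  filter_upwards [hs.vec_coeFn i, hh.coeFn_toLp] with z hz hz'
  rw [hz, hz', RCLike.inner_apply, Complex.conj_ofReal]

theorem inner_vec_vec (i j : ℕ) :
    inner ℂ (hs.vec i) (hs.vec j) = ∫ z, (φ j z : ℂ) * φ i z ∂unitVol :=
  hs.inner_vec_toLp i (hs.memLp j)

theorem inner_vec_self (i : ℕ) : inner ℂ (hs.vec i) (hs.vec i) = (1 : ℂ) := by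
  rw [hs.inner_vec_vec, integral_unitVol]
  simp_rw [← Complex.ofReal_mul, ← pow_two]
  rw [intervalIntegral.integral_ofReal, hs.normalized i, Complex.ofReal_one]

theorem inner_vec_of_ne {i j : ℕ} (hij : i ≠ j) : inner ℂ (hs.vec i) (hs.vec j) = (0 : ℂ) := by
  rw [hs.inner_vec_vec]
  have e := (hs.eigen j).1.integral_mul_comm (hs.eigen i).1 (hs.integrable_const_mul j _)
    (hs.integrable_const_mul i _)
  simp_rw [mul_left_comm _ (lam i : ℂ), mul_assoc] at e
  rw [integral_const_mul, integral_const_mul, ← sub_eq_zero, ← sub_mul] at e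
  refine (mul_eq_zero.1 e).resolve_left ?_
  rw [sub_eq_zero, Complex.ofReal_inj]
  exact hs.strictAnti.injective.ne hij.symm

theorem orthonormal_vec : Orthonormal ℂ hs.vec := by
  refine orthonormal_iff_ite.2 fun i j => ?_
  split_ifs with hij
  · rw [hij, hs.inner_vec_self]
  · exact hs.inner_vec_of_ne hij

theorem slInverse_apply_vec (h0 : lam 0 < 0) {T : StateSpace →L[ℂ] StateSpace}
    (hT : IsSLInverse ρ a q₀ q₁ T) (i : ℕ) : T (hs.vec i) = ((lam i)⁻¹ : ℂ) • hs.vec i := by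
  have hi : (lam i : ℂ) ≠ 0 :=
    Complex.ofReal_ne_zero.2 ((hs.strictAnti.antitone (Nat.zero_le i)).trans_lt h0).ne
  refine hT.apply_eq_of_slGraph (hs.not_isEigenpair_zero h0)
    (((hs.eigen i).1.const_smul (lam i : ℂ)⁻¹).congr_ae ?_) ?_
  · filter_upwards [hs.vec_coeFn i] with z hz
    rw [hz, Pi.smul_apply, smul_eq_mul, inv_mul_cancel_left₀ hi]
  · filter_upwards [Lp.coeFn_smul (lam i : ℂ)⁻¹ (hs.vec i), hs.vec_coeFn i] with z hz hz'
    rw [hz, Pi.smul_apply, hz', Pi.smul_apply]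

theorem mem_span_vec_of_isEigenpair (hρ : ρ ≠ 0) (ha : Integrable a unitVol) {μ : ℝ} {h : ℝ → ℂ}
    (H : IsEigenpair ρ a q₀ q₁ μ h) {f : StateSpace} (hf : f =ᵐ[unitVol] h) :
    f ∈ Submodule.span ℂ (range hs.vec) := by
  obtain ⟨i, rfl⟩ := hs.exhaustive μ ⟨h, H⟩
  have hφ := (hs.eigen i).apply_zero_ne_zero hρ ha
  have e := H.1.smul_eqOn_smul_of_eigen hρ ha (hs.eigen i).1
  suffices f = (h 0 / φ i 0) • hs.vec i from
    this ▸ Submodule.smul_mem _ _ (Submodule.subset_span ⟨i, rfl⟩)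
  refine Lp.ext ?_
  filter_upwards [ae_restrict_mem measurableSet_Ioo, hf, hs.vec_coeFn i,
    Lp.coeFn_smul (h 0 / φ i 0) (hs.vec i)] with z hz hfz hvz hsmul
  have ez := e (Ioo_subset_Icc_self hz)
  simp only [Pi.smul_apply, smul_eq_mul] at ez
  rw [hsmul, hfz, Pi.smul_apply, hvz, smul_eq_mul, div_mul_eq_mul_div, eq_div_iff hφ, ← ez,
    mul_comm]

theorem orthogonal_span_vec_of_neg (hρ : ρ ≠ 0) (ha : MemLp a 2 unitVol) (h0 : lam 0 < 0) :
    (Submodule.span ℂ (range hs.vec))ᗮ = ⊥ := by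
  obtain ⟨T, hT, hTc⟩ := exists_isSLInverse_isCompactOperator hρ ha (hs.not_isEigenpair_zero h0)
  have hsym := hT.isSymmetric
  rw [eq_bot_iff, ← ContinuousLinearMap.orthogonalComplement_iSup_eigenspaces_eq_bot hTc hsym]
  refine Submodule.orthogonal_le (iSup_le fun μ f hf => ?_)
  rcases eq_or_ne f 0 with rfl | hf0
  · exact zero_mem _
  have hμ : conj μ = μ := hsym.conj_eigenvalue_eq_self
    (Module.End.hasEigenvalue_of_hasEigenvector ⟨hf, hf0⟩)
  obtain ⟨r, rfl⟩ := Complex.conj_eq_iff_real.1 hμ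
  obtain ⟨h, hfh, H⟩ := hT.exists_isEigenpair_of_apply_eq_smul
    (Module.End.mem_eigenspace_iff.1 hf) hf0
  rw [← Complex.ofReal_inv] at H
  exact hs.mem_span_vec_of_isEigenpair hρ (ha.integrable one_le_two) H hfh

theorem tendsto_atBot_of_neg (hρ : ρ ≠ 0) (ha : MemLp a 2 unitVol) (h0 : lam 0 < 0) :
    Tendsto lam atTop atBot := by
  obtain ⟨T, hT, hTc⟩ := exists_isSLInverse_isCompactOperator hρ ha (hs.not_isEigenpair_zero h0)
  have hlim := (tendsto_apply_of_orthonormal hTc hs.orthonormal_vec).norm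
  simp only [hs.slInverse_apply_vec h0 hT, norm_smul, hs.orthonormal_vec.1, mul_one, norm_zero,
    ← Complex.ofReal_inv, Complex.norm_real, tendsto_zero_iff_norm_tendsto_zero.symm] at hlim
  have hneg : ∀ i, (lam i)⁻¹ < 0 := fun i =>
    inv_lt_zero.2 ((hs.strictAnti.antitone (Nat.zero_le i)).trans_lt h0)
  simpa only [Function.comp_def, inv_inv] using tendsto_inv_nhdsLT_zero.comp
    (tendsto_nhdsWithin_iff.2 ⟨hlim, .of_forall hneg⟩)

theorem orthogonal_span_vec (hρ : ρ ≠ 0) (ha : MemLp a 2 unitVol) :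
    (Submodule.span ℂ (range hs.vec))ᗮ = ⊥ :=
  (hs.sub_potential (lam 0 + 1)).orthogonal_span_vec_of_neg hρ (ha.sub (memLp_const _))
    (by linarith)

theorem tendsto_atBot (hρ : ρ ≠ 0) (ha : MemLp a 2 unitVol) : Tendsto lam atTop atBot := by
  simpa using tendsto_atBot_add_const_right _ (lam 0 + 1)
    ((hs.sub_potential (lam 0 + 1)).tendsto_atBot_of_neg hρ (ha.sub (memLp_const _))
      (by linarith))

end IsEigensystem

section CubicLifting

open Polynomial

theorem isSobolevH2_polynomial (p : ℂ[X]) : IsSobolevH2 (fun z : ℝ => p.eval (z : ℂ))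
    (fun z => p.derivative.eval (z : ℂ)) (fun z => p.derivative.derivative.eval (z : ℂ)) := by
  have hcont (q : ℂ[X]) : Continuous fun z : ℝ => q.eval (z : ℂ) := by fun_prop
  have hmem (q : ℂ[X]) : MemLp (fun z : ℝ => q.eval (z : ℂ)) 2 unitVol :=
    memLp_unitVol_of_continuousOn (hcont q).continuousOn 2
  have hprim (q : ℂ[X]) (z : ℝ) :
      q.eval (z : ℂ) = q.eval ((0 : ℝ) : ℂ) + ∫ t in (0 : ℝ)..z, q.derivative.eval (t : ℂ) := by
    rw [intervalIntegral.integral_eq_sub_of_hasDerivAt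
      (fun t _ => (q.hasDerivAt (t : ℂ)).comp_ofReal) ((hcont _).intervalIntegrable _ _),
      add_sub_cancel]
  exact ⟨hmem _, hmem _, hmem _, fun z _ => hprim _ z, fun z _ => hprim _ z⟩

theorem exists_isSobolevH2_boundary_deriv (α β : ℂ) : ∃ h h₁ h₂ : ℝ → ℂ, IsSobolevH2 h h₁ h₂ ∧
    h 0 = 0 ∧ h 1 = 0 ∧ h₁ 0 = α ∧ h₁ 1 = β :=
  ⟨_, _, _, isSobolevH2_polynomial (C α * (X * (1 - X) ^ 2) + C β * (X ^ 2 * (X - 1))),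
    by simp, by simp, by simp [derivative_pow], by simp [derivative_pow]⟩

end CubicLifting

theorem coeffRow_of_le {ρ : ℝ} {lam : ℕ → ℝ} {φ : ℕ → ℝ → ℝ} {n : ℕ} {lamt : Fin n → ℂ}
    (P : Matrix (Fin 2) (Fin n) ℂ) (V : Matrix (Fin n) (Fin n) ℂ) {i : ℕ} (hi : n ≤ i)
    (hlam : ∀ k, lamt k ≠ lam i) (j : Fin n) :
    coeffRow ρ lam φ lamt P V i j
      = ∑ k, (inputVec ρ φ i ⬝ᵥ P.col k) / (lamt k - lam i) * V⁻¹ k j := by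
  have hdiag : (Matrix.diagonal lamt - (lam i : ℂ) • (1 : Matrix (Fin n) (Fin n) ℂ))⁻¹
      = Matrix.diagonal fun k => (lamt k - lam i)⁻¹ := by
    refine Matrix.inv_eq_right_inv ?_
    rw [Matrix.smul_one_eq_diagonal, Matrix.diagonal_sub, Matrix.diagonal_mul_diagonal,
      ← Matrix.diagonal_one]
    exact congrArg _ (funext fun k => mul_inv_cancel₀ (sub_ne_zero.2 (hlam k)))
  rw [coeffRow, dif_neg hi.not_gt, hdiag, ← Matrix.vecMul_vecMul, ← Matrix.vecMul_vecMul,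
    Matrix.vecMul, dotProduct]
  refine Finset.sum_congr rfl fun k _ => ?_
  rw [Matrix.vecMul_diagonal, div_eq_mul_inv]
  rfl

namespace IsEigensystem

variable {ρ : ℝ} {a : ℝ → ℝ} {q₀ q₁ : ℝ} {lam : ℕ → ℝ} {φ : ℕ → ℝ → ℝ}
  (hs : IsEigensystem ρ a q₀ q₁ lam φ)

include hs

theorem exists_inputVec_dotProduct_eq (ha : MemLp a 2 unitVol) (α : Fin 2 → ℂ) :
    ∃ F G : StateSpace, ∀ i, inputVec ρ φ i ⬝ᵥ α
      = inner ℂ (hs.vec i) F - lam i * inner ℂ (hs.vec i) G := by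
  obtain ⟨h, h₁, h₂, H, h0, h1, h10, h11⟩ := exists_isSobolevH2_boundary_deriv (α 0) (α 1)
  have hF : MemLp (fun z => ρ * h₂ z + a z * h z) 2 unitVol :=
    (H.memLp_two.const_mul _).add
      ((memLp_unitVol_of_continuousOn H.continuousOn ⊤).mul ha.ofReal)
  refine ⟨hF.toLp, H.memLp.toLp, fun i => ?_⟩
  calc inputVec ρ φ i ⬝ᵥ α = ρ * ((h₁ 1 - q₁ * h 1) * φ i 1 - (h₁ 0 - q₀ * h 0) * φ i 0) := by
        rw [h0, h1, h10, h11]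
        simp only [inputVec, Matrix.vec2_dotProduct, Matrix.cons_val_zero, Matrix.cons_val_one]
        ring
    _ = ∫ z, ((ρ * h₂ z + a z * h z) * φ i z - h z * (lam i * φ i z)) ∂unitVol :=
        ((hs.eigen i).1.green H).symm
    _ = inner ℂ (hs.vec i) hF.toLp - lam i * inner ℂ (hs.vec i) H.memLp.toLp := by
        rw [hs.inner_vec_toLp, hs.inner_vec_toLp, ← integral_const_mul]
        simp_rw [mul_left_comm (h _)]
        exact integral_sub (MemLp.integrable_mul hF (hs.memLp i))
          ((MemLp.integrable_mul H.memLp (hs.memLp i)).const_mul _)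

theorem summable_inputVec_div (hρ : ρ ≠ 0) (ha : MemLp a 2 unitVol) (α : Fin 2 → ℂ) (μ : ℂ) :
    Summable fun i => ‖(inputVec ρ φ i ⬝ᵥ α) / (μ - lam i)‖ ^ 2 := by
  obtain ⟨F, G, hFG⟩ := hs.exists_inputVec_dotProduct_eq ha α
  have hsum : Summable fun i =>
      2 * (‖inner ℂ (hs.vec i) (F - μ • G)‖ ^ 2 + ‖inner ℂ (hs.vec i) G‖ ^ 2) :=
    ((hs.orthonormal_vec.inner_products_summable _).add
      (hs.orthonormal_vec.inner_products_summable _)).mul_left 2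
  have hlam : ∀ᶠ i in atTop, lam i ≤ μ.re - 1 := (hs.tendsto_atBot hρ ha).eventually_le_atBot _
  refine hsum.of_norm_bounded_eventually_nat ?_
  filter_upwards [hlam] with i hi
  have hge : 1 ≤ ‖μ - lam i‖ := by
    refine le_trans ?_ (Complex.re_le_norm _)
    rw [Complex.sub_re, Complex.ofReal_re]
    linarith
  have hne : μ - lam i ≠ 0 := norm_pos_iff.1 (zero_lt_one.trans_le hge)
  rw [norm_pow, norm_norm]
  calc ‖(inputVec ρ φ i ⬝ᵥ α) / (μ - lam i)‖ ^ 2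
      = ‖inner ℂ (hs.vec i) (F - μ • G) / (μ - lam i) + inner ℂ (hs.vec i) G‖ ^ 2 := by
        rw [hFG, inner_sub_right, inner_smul_right, div_add' _ _ _ hne]
        ring_nf
    _ ≤ (‖inner ℂ (hs.vec i) (F - μ • G)‖ + ‖inner ℂ (hs.vec i) G‖) ^ 2 := by
        gcongr
        refine (norm_add_le _ _).trans (add_le_add_left ?_ _)
        exact (norm_div _ _).trans_le (div_le_self (norm_nonneg _) hge)
    _ ≤ 2 * (‖inner ℂ (hs.vec i) (F - μ • G)‖ ^ 2 + ‖inner ℂ (hs.vec i) G‖ ^ 2) := add_sq_le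

theorem summable_coeffRow (hρ : ρ ≠ 0) (ha : MemLp a 2 unitVol) {n : ℕ} {lamt : Fin n → ℂ}
    (P : Matrix (Fin 2) (Fin n) ℂ) (V : Matrix (Fin n) (Fin n) ℂ)
    (hspec : ∀ i, lamt i ∉ spectrumTail lam n) (j : Fin n) :
    Summable fun i => ‖coeffRow ρ lam φ lamt P V i j‖ ^ 2 := by
  have hsum : Summable fun i => (n : ℝ) *
      ∑ k, ‖(inputVec ρ φ i ⬝ᵥ P.col k) / (lamt k - lam i)‖ ^ 2 * ‖V⁻¹ k j‖ ^ 2 :=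
    (summable_sum fun k _ =>
      (hs.summable_inputVec_div hρ ha (P.col k) (lamt k)).mul_right _).mul_left _
  refine hsum.of_norm_bounded_eventually_nat ?_
  filter_upwards [eventually_ge_atTop n] with i hi
  rw [norm_pow, norm_norm, coeffRow_of_le P V hi fun k h => hspec k ⟨i, hi, h⟩]
  simp_rw [← mul_pow, ← norm_mul]
  refine (pow_le_pow_left₀ (norm_nonneg _) (norm_sum_le _ _) 2).trans ?_
  simpa only [Finset.card_univ, Fintype.card_fin] using
    sq_sum_le_card_mul_sum_sq (α := ℝ) (s := (Finset.univ : Finset (Fin n)))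

end IsEigensystem

section RieszBasis

variable {H : Type*} [NormedAddCommGroup H] [InnerProductSpace ℂ H]

theorem isRieszBasis_of_equiv (b : HilbertBasis ℕ ℂ H) (R : H ≃L[ℂ] H) :
    IsRieszBasis fun i => R (b i) := by
  refine ⟨?_, (‖(R.symm : H →L[ℂ] H)‖ ^ 2 + 1)⁻¹, ‖(R : H →L[ℂ] H)‖ ^ 2 + 1, by positivity,
    by positivity, fun s α => ?_⟩
  · have hb := Submodule.dense_iff_topologicalClosure_eq_top.2 b.dense_span
    have hspan : Submodule.span ℂ (range fun i => R (b i))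
        = (Submodule.span ℂ (range b)).map (R : H →ₗ[ℂ] H) := by
      rw [Submodule.map_span, ← range_comp]
      rfl
    rw [← Submodule.dense_iff_topologicalClosure_eq_top, hspan]
    exact R.surjective.denseRange.dense_image R.continuous hb
  · set x := ∑ i ∈ s, α i • b i with hx
    have hR : ∑ i ∈ s, α i • R (b i) = R x := by simp only [hx, map_sum, map_smul]
    have hnorm : ∑ i ∈ s, ‖α i‖ ^ 2 = ‖x‖ ^ 2 := by
      simpa using (b.orthonormal.orthogonalFamily.norm_sum α s).symm
    have hle (A : H →L[ℂ] H) (y : H) : ‖A y‖ ^ 2 ≤ (‖A‖ ^ 2 + 1) * ‖y‖ ^ 2 :=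
      calc ‖A y‖ ^ 2 ≤ (‖A‖ * ‖y‖) ^ 2 := by gcongr; exact A.le_opNorm y
        _ ≤ (‖A‖ ^ 2 + 1) * ‖y‖ ^ 2 := by
          rw [mul_pow]
          gcongr
          exact le_add_of_nonneg_right zero_le_one
    rw [hR, hnorm, inv_mul_le_iff₀ (by positivity)]
    exact ⟨by simpa using hle R.symm (R x), hle R x⟩

variable {n : ℕ} (b : HilbertBasis ℕ ℂ H)

theorem exists_inner_eq_of_summable {c : ℕ → ℂ} (hc : Summable fun i => ‖c i‖ ^ 2) :
    ∃ d : H, ∀ i, inner ℂ d (b i) = c i := by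
  have hmem : Memℓp (fun i => conj (c i)) 2 := memℓp_gen (by simpa using hc)
  refine ⟨b.repr.symm ⟨_, hmem⟩, fun i => ?_⟩
  rw [← inner_conj_symm, ← b.repr_apply_apply]
  simp

theorem sum_inner_smul_eq_ite (i : ℕ) :
    ∑ j : Fin n, inner ℂ (b j) (b i) • b j = if i < n then b i else 0 := by
  simp only [orthonormal_iff_ite.1 b.orthonormal, ite_smul, one_smul, zero_smul]
  split_ifs with hi
  · rw [Fintype.sum_eq_single ⟨i, hi⟩ fun j hj => if_neg fun h => hj (Fin.ext h), if_pos rfl]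
  · exact Finset.sum_eq_zero fun j _ => if_neg fun h : (j : ℕ) = i => hi (h ▸ j.2)

/-- The finite-rank operator `K` for which `x + K x` arises from `x` by changing its first `n`
coordinates with respect to `b` into the numbers `⟪d j, x⟫`. -/
noncomputable def coordChange (d : Fin n → H) : H →L[ℂ] H :=
  ∑ j, (innerSL ℂ (d j - b j)).smulRight (b j)

theorem coordChange_apply (d : Fin n → H) (x : H) :
    coordChange b d x = ∑ j, inner ℂ (d j - b j) x • b j := by
  simp [coordChange]

theorem isCompactOperator_coordChange (d : Fin n → H) : IsCompactOperator (coordChange b d) :=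
  (compactOperator (RingHom.id ℂ) H H).sum_mem fun _ _ => isCompactOperator_smulRight _ _

theorem add_coordChange_apply_basis (d : Fin n → H) (i : ℕ) :
    b i + coordChange b d (b i)
      = (∑ j, inner ℂ (d j) (b i) • b j) + if i < n then 0 else b i := by
  simp_rw [coordChange_apply, inner_sub_left, sub_smul, Finset.sum_sub_distrib,
    sum_inner_smul_eq_ite]
  split_ifs <;> abel

theorem eq_zero_of_add_coordChange_eq_zero {d : Fin n → H}
    (hd : ∀ y : Fin n → ℂ, (∀ j, ∑ i : Fin n, y i * inner ℂ (d j) (b i) = 0) → y = 0) {x : H}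
    (hx : x + coordChange b d x = 0) : x = 0 := by
  set y : Fin n → ℂ := fun j => -inner ℂ (d j - b j) x with hy
  have hxy : x = ∑ i : Fin n, y i • b i := by
    rw [eq_neg_of_add_eq_zero_left hx, coordChange_apply, ← Finset.sum_neg_distrib]
    simp only [hy, neg_smul]
  have hsum : ∑ j : Fin n, (∑ i : Fin n, y i * inner ℂ (d j) (b i)) • b j = 0 :=
    calc ∑ j : Fin n, (∑ i : Fin n, y i * inner ℂ (d j) (b i)) • b j
        = ∑ i : Fin n, y i • (b i + coordChange b d (b i)) := by
          simp_rw [add_coordChange_apply_basis, Fin.is_lt, if_true, add_zero, Finset.smul_sum,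
            smul_smul, Finset.sum_smul]
          exact Finset.sum_comm
      _ = x + coordChange b d x := by
          simp_rw [smul_add, Finset.sum_add_distrib, ← map_smul, ← map_sum, ← hxy]
      _ = 0 := hx
  have hli : LinearIndependent ℂ fun j : Fin n => b j :=
    b.orthonormal.linearIndependent.comp _ Fin.val_injective
  rw [hxy, hd y (Fintype.linearIndependent_iff.1 hli _ hsum)]
  simp only [Pi.zero_apply, zero_smul, Finset.sum_const_zero]

theorem isRieszBasis_of_blockTriangular [CompleteSpace H] {C : ℕ → Fin n → ℂ}
    (hC : ∀ j, Summable fun i => ‖C i j‖ ^ 2)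
    (hinv : ∀ y : Fin n → ℂ, (∀ j, ∑ i : Fin n, y i * C i j = 0) → y = 0) :
    IsRieszBasis fun i => (∑ j : Fin n, C i j • b j) + if i < n then 0 else b i := by
  choose d hd using fun j => exists_inner_eq_of_summable b (hC j)
  obtain ⟨R, hR⟩ := exists_equiv_one_add_of_isCompactOperator (isCompactOperator_coordChange b d)
    fun x hx => eq_zero_of_add_coordChange_eq_zero b (by simpa only [hd] using hinv) hx
  simpa only [hR, add_coordChange_apply_basis, hd] using isRieszBasis_of_equiv b R

end RieszBasis

theorem IsAssignedBy.isUnit_det {n : ℕ} {Lam : Matrix (Fin n) (Fin n) ℂ}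
    {B : Matrix (Fin n) (Fin 2) ℂ} {K : Matrix (Fin 2) (Fin n) ℂ} {lamt : Fin n → ℂ}
    {P : Matrix (Fin 2) (Fin n) ℂ} {V : Matrix (Fin n) (Fin n) ℂ}
    (hK : IsAssignedBy Lam B K lamt P V) (hinj : Function.Injective lamt) : IsUnit V.det := by
  have hmem (i : Fin n) : Matrix.toLin' (Lam - B * K) (V.col i) = lamt i • V.col i := by
    have hi := hK.modal i
    rw [Matrix.sub_mulVec, Matrix.smul_mulVec, Matrix.one_mulVec, hK.gain i] at hi
    rw [Matrix.toLin'_apply, Matrix.sub_mulVec, ← Matrix.mulVec_mulVec, ← hi, sub_sub_cancel]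
  rw [← Matrix.isUnit_iff_isUnit_det, ← Matrix.linearIndependent_cols_iff_isUnit]
  exact Module.End.eigenvectors_linearIndependent' _ lamt hinj V.col fun i =>
    ⟨Module.End.mem_eigenspace_iff.2 (hmem i), hK.ne_zero i⟩

theorem eq_zero_of_sum_mul_star_coeffRow_eq_zero {ρ : ℝ} {lam : ℕ → ℝ} {φ : ℕ → ℝ → ℝ} {n : ℕ}
    {lamt : Fin n → ℂ} {P : Matrix (Fin 2) (Fin n) ℂ} {V : Matrix (Fin n) (Fin n) ℂ}
    (hV : IsUnit V.det) {y : Fin n → ℂ}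
    (hy : ∀ j, ∑ i : Fin n, y i * star (coeffRow ρ lam φ lamt P V i j) = 0) : y = 0 := by
  have hVy : Matrix.vecMul (star y) V⁻¹ = 0 := by
    ext j
    simpa [coeffRow, Matrix.vecMul, dotProduct, mul_comm] using congrArg star (hy j)
  have hy0 : Matrix.vecMul (star y) (V⁻¹ * V) = 0 := by
    rw [← Matrix.vecMul_vecMul, hVy, Matrix.zero_vecMul]
  rwa [Matrix.nonsing_inv_mul V hV, Matrix.vecMul_one, star_eq_zero] at hy0

/-- The eigenvectors as a Hilbert basis of `L₂(0,1)`. -/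
noncomputable def IsEigensystem.hilbertBasis {ρ : ℝ} {a : ℝ → ℝ} {q₀ q₁ : ℝ} {lam : ℕ → ℝ}
    {φ : ℕ → ℝ → ℝ} (hs : IsEigensystem ρ a q₀ q₁ lam φ) (hρ : ρ ≠ 0) (ha : MemLp a 2 unitVol) :
    HilbertBasis ℕ ℂ StateSpace :=
  .mkOfOrthogonalEqBot hs.orthonormal_vec (hs.orthogonal_span_vec hρ ha)

theorem lemma1_general {ρ : ℝ} (hρ : ρ ≠ 0) {a : ℝ → ℝ} (ha : MemLp a 2 unitVol) {q₀ q₁ : ℝ}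
    {lam : ℕ → ℝ} {φ : ℕ → ℝ → ℝ} (hs : IsEigensystem ρ a q₀ q₁ lam φ) {n : ℕ}
    {lamt : Fin n → ℂ} (P : Matrix (Fin 2) (Fin n) ℂ) {V : Matrix (Fin n) (Fin n) ℂ}
    (hV : IsUnit V.det) (hspec : ∀ i, lamt i ∉ spectrumTail lam n) :
    IsRieszBasis (closedLoopVec hs lamt P V) := by
  have hsum (j : Fin n) : Summable fun i => ‖star (coeffRow ρ lam φ lamt P V i j)‖ ^ 2 := by
    simpa only [norm_star] using hs.summable_coeffRow hρ ha P V hspec j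
  have h := isRieszBasis_of_blockTriangular (hs.hilbertBasis hρ ha) hsum
    fun _ => eq_zero_of_sum_mul_star_coeffRow_eq_zero hV
  rwa [IsEigensystem.hilbertBasis, HilbertBasis.coe_mkOfOrthogonalEqBot] at h

theorem lemma1 (ρ : ℝ) (hρ : 0 < ρ) (a : ℝ → ℝ) (ha : ContinuousOn a (Set.Icc 0 1)) (q₀ q₁ : ℝ)
    (lam : ℕ → ℝ) (φ : ℕ → ℝ → ℝ) (hs : IsEigensystem ρ a q₀ q₁ lam φ)
    (n : ℕ) (K : Matrix (Fin 2) (Fin n) ℂ) (lamt : Fin n → ℂ)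
    (P : Matrix (Fin 2) (Fin n) ℂ) (V : Matrix (Fin n) (Fin n) ℂ)
    (hK : IsAssignedBy (lamMatrix lam n) (inputMatrix ρ φ n) K lamt P V)
    (hdistinct : Function.Injective lamt)
    (hspec : ∀ i, lamt i ∉ spectrumTail lam n) :
    IsRieszBasis (closedLoopVec hs lamt P V) :=
  lemma1_general hρ.ne' (memLp_unitVol_of_continuousOn ha 2) hs P (hK.isUnit_det hdistinct) hspec
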